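/- Let $\mathbb H$ be the real quaternions, $\mathbb S^2$ the sphere of purely imaginary quaternions of modulus $1$, $\mathbb C(\mathbf i)=\mathbb R+\mathbb R\mathbf i$ for $\mathbf i\in\mathbb S^2$, and $\mathbb B^4=\{q\in\mathbb H:|q|<1\}$. A real differentiable function $f:\mathbb B^4\to\mathbb H$ is (left) slice regular if for every $\mathbf i\in\mathbb S^2$ one has $\partial_x f(x+y\mathbf i)+\mathbf i\,\partial_y f(x+y\mathbf i)=0$ on $\mathbb B^4\cap\mathbb C(\mathbf i)$, and slice right anti-regular if $\partial_x f(x+y\mathbf i)-\partial_y f(x+y\mathbf i)\,\mathbf i=0$ there. For $\mathbf j\in\mathbb S^2$ let $\mathcal A(\mathbb B^4_{\mathbf j})$ be the space of slice regular functions $f$ on $\mathbb B^4$ with $\int_{\mathbb B^4\cap\mathbb C(\mathbf j)}|f|^2\,dx\,dy<\infty$, with inner product $\langle f,g\rangle=\int_{\mathbb B^4\cap\mathbb C(\mathbf j)}\bar f g\,dx\,dy$. For every $q\in\mathbb B^4\cap\mathbb C(\mathbf j)$ there is exactly one $K_q(\mathbf j)\in\mathcal A(\mathbb B^4_{\mathbf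 j})$ such that $f(q)=\langle K_q(\mathbf j),f\rangle$ for all $f\in\mathcal A(\mathbb B^4_{\mathbf j})$. Put $\mathcal K_{\mathbf j}(q,r)=\overline{K_q(\mathbf j)(r)}$. The slice Bergman kernel of the second kind of $\mathbb B^4$ is $$\mathcal K_{\mathbb B^4}(x+y\mathbf i,r)=\tfrac12(1-\mathbf i\mathbf j)\,\mathcal K_{\mathbf j}(x+y\mathbf j,r)+\tfrac12(1+\mathbf i\mathbf j)\,\mathcal K_{\mathbf j}(x-y\mathbf j,r),\qquad x+y\mathbf i,\ r\in\mathbb B^4,\ \mathbf i\in\mathbb S^2 .$$ Then, for every choice of $\mathbf j\in\mathbb S^2$ and all $q,r\in\mathbb B^4$, $$\mathcal K_{\mathbb B^4}(q,r)=\frac1\pi\bigl(1-2q\,\mathrm{Re}(r)+q^2|r|^2\bigr)^{-2}\bigl(1-2qr+q^2r^2\bigr),$$ and this agrees with $$\frac1\pi\bigl(1-2\bar q\bar r+\bar q^2\bar r^2\bigr)\bigl(1-2\,\mathrm{Re}(q)\,\bar r+|q|^2\bar r^2\bigr)^{-2}.$$ The first of these two expressions, and hence the kernel, is slice regular in $q\in\mathbb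 B^4$ for each fixed $r\in\mathbb B^4$, and slice right anti-regular in $r\in\mathbb B^4$ for each fixed $q\in\mathbb B^4$. -/

import Mathlib

open scoped Quaternion

noncomputable section

namespace SliceBergman

/-- The sphere of imaginary units: purely imaginary quaternions of modulus one. -/
def imagUnits : Set ℍ := {I | I.re = 0 ∧ ‖I‖ = 1}

/-- The quaternion `x + y I`. -/
def slicePoint (I : ℍ) (x y : ℝ) : ℍ := (x : ℍ) + y • I

/-- The plane `ℂ(I)`, the real span of `1` and `I`. -/
def slicePlane (I : ℍ) : Set ℍ := {q | ∃ x y : ℝ, q = slicePoint I x y}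

/-- (Left) slice regular functions on an open set `Ω`: real differentiable, with
`(∂/∂x + I ∂/∂y) f(x + y I) = 0` on `Ω ∩ ℂ(I)` for every imaginary unit `I`. -/
def SliceRegularOn (f : ℍ → ℍ) (Ω : Set ℍ) : Prop :=
  DifferentiableOn ℝ f Ω ∧
    ∀ I ∈ imagUnits, ∀ x y : ℝ, slicePoint I x y ∈ Ω →
      deriv (fun t : ℝ => f (slicePoint I t y)) x
        + I * deriv (fun t : ℝ => f (slicePoint I x t)) y = 0

/-- Slice right anti-regular functions on an open set `Ω`: real differentiable, with
`f(x + y I) (∂/∂x - I ∂/∂y) = 0` on `Ω ∩ ℂ(I)`, the operator acting from the right,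
for every imaginary unit `I`. -/
def SliceRightAntiRegularOn (f : ℍ → ℍ) (Ω : Set ℍ) : Prop :=
  DifferentiableOn ℝ f Ω ∧
    ∀ I ∈ imagUnits, ∀ x y : ℝ, slicePoint I x y ∈ Ω →
      deriv (fun t : ℝ => f (slicePoint I t y)) x
        - deriv (fun t : ℝ => f (slicePoint I x t)) y * I = 0

/-- The slice `Ω ∩ ℂ(I)` in the coordinates `(x, y)` of `x + y I`. -/
def sliceSet (Ω : Set ℍ) (I : ℍ) : Set (ℝ × ℝ) := {p | slicePoint I p.1 p.2 ∈ Ω}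

/-- The Bergman space `A(Ω_I)`: slice regular functions on `Ω` that are square integrable on
`Ω ∩ ℂ(I)` with respect to the area measure `dx dy`. -/
def bergmanSpace (Ω : Set ℍ) (I : ℍ) : Set (ℍ → ℍ) :=
  {f | SliceRegularOn f Ω ∧
    MeasureTheory.IntegrableOn (fun p : ℝ × ℝ => ‖f (slicePoint I p.1 p.2)‖ ^ 2) (sliceSet Ω I)}

/-- The quaternion-valued inner product `⟨f, g⟩ = ∫ conj(f) g dx dy` over `Ω ∩ ℂ(I)`. -/
def bergmanInner (Ω : Set ℍ) (I : ℍ) (f g : ℍ → ℍ) : ℍ :=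
  ∫ p in sliceSet Ω I, star (f (slicePoint I p.1 p.2)) * g (slicePoint I p.1 p.2)

/-- `K` represents the evaluation functional `f ↦ f q` on `A(Ω_I)`. -/
def IsEvalRepresenter (Ω : Set ℍ) (I q : ℍ) (K : ℍ → ℍ) : Prop :=
  K ∈ bergmanSpace Ω I ∧ ∀ f ∈ bergmanSpace Ω I, f q = bergmanInner Ω I K f

/-- The representer `K_q(I)` of the evaluation at `q ∈ Ω ∩ ℂ(I)`. -/
def evalRepresenter (Ω : Set ℍ) (I q : ℍ) : ℍ → ℍ :=
  Classical.epsilon (IsEvalRepresenter Ω I q)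

/-- The slice Bergman kernel associated with `Ω ∩ ℂ(I)`: the conjugate of `K_q(I)`. -/
def planeKernel (Ω : Set ℍ) (I q r : ℍ) : ℍ := star (evalRepresenter Ω I q r)

/-- The imaginary unit `I_q` with `q = q.re + ‖q.im‖ I_q`. For real `q` every imaginary unit has
this property; the value is then `0`, and `sliceExtension` does not depend on the choice. -/
def unitOf (q : ℍ) : ℍ := ‖q.im‖⁻¹ • q.im

/-- The extension operator `P_J` from the plane `ℂ(J)`, given by the representation formula
`P_J[g](x + I y) = ½ (1 - I J) g(x + y J) + ½ (1 + I J) g(x - y J)`. -/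
def sliceExtension (J : ℍ) (g : ℍ → ℍ) (q : ℍ) : ℍ :=
  (1 / 2 : ℝ) • ((1 - unitOf q * J) * g (slicePoint J q.re ‖q.im‖))
    + (1 / 2 : ℝ) • ((1 + unitOf q * J) * g (slicePoint J q.re (-‖q.im‖)))

/-- The slice Bergman kernel of the second kind associated with `Ω`, built from the plane `ℂ(J)`:
the extension in the first variable of the slice Bergman kernel of `Ω ∩ ℂ(J)`. -/
def bergmanKernel (Ω : Set ℍ) (J q r : ℍ) : ℍ :=
  sliceExtension J (fun z => planeKernel Ω J z r) q

/-- The open unit ball of the quaternions. -/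
def unitBall : Set ℍ := {q | ‖q‖ < 1}

/-- `(1/π) (1 - 2 q̄ r̄ + q̄² r̄²) (1 - 2 Re(q) r̄ + |q|² r̄²)⁻²`. -/
def firstForm (q r : ℍ) : ℍ :=
  (1 / Real.pi : ℝ) •
    ((1 - 2 * star q * star r + star q ^ 2 * star r ^ 2)
      * (1 - 2 * (q.re : ℍ) * star r + ((‖q‖ ^ 2 : ℝ) : ℍ) * star r ^ 2) ^ (-2 : ℤ))

/-- `(1/π) (1 - 2 q Re(r) + q² |r|²)⁻² (1 - 2 q r + q² r²)`. -/
def secondForm (q r : ℍ) : ℍ :=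
  (1 / Real.pi : ℝ) •
    ((1 - 2 * q * (r.re : ℍ) + q ^ 2 * ((‖r‖ ^ 2 : ℝ) : ℍ)) ^ (-2 : ℤ)
      * (1 - 2 * q * r + q ^ 2 * r ^ 2))

end SliceBergman

end

/-!
On a slice `ℂ(J)` the kernel `secondForm` is the classical Bergman kernel `π⁻¹ (1 - z w̄)⁻²` of the
disc, since `1 - 2 z Re(w) + z² |w|² = (1 - z w) (1 - z w̄)` there. The proof shows that
`r ↦ secondForm r q` represents the evaluation at `q`, and that the representation formula extends
`secondForm` from a slice to itself.

*Reproducing property.* The classical kernel reproduces integrable holomorphic functions on the disc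
(`integral_bergman_mul`): on a circle it is the Cauchy kernel of a derivative, and the radial
integral that remains is evaluated by the fundamental theorem of calculus. A slice regular function
restricted to a slice has values in `ℍ`, a complex vector space through left multiplication by
`ℂ(J)`; the complex linear functionals `complexPart J c` separate points, and turn it into scalar
holomorphic functions (`SliceRegularOn.differentiableAt_complexPart`). As the kernel acts from the
left, the scalar case suffices (`isEvalRepresenter_secondForm`).

*Uniqueness.* Pairing a representer with the explicit ones determines it on the slice
(`IsEvalRepresenter.eqOn_secondForm`). All slices share the real diameter, so the identity theorem
for the complex components determines it on the ball (`SliceRegularOn.eqOn_unitBall`).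

*Closed forms and regularity.* The two closed forms are the Bergman analogue of the equality
`(1 - 2 q Re(r) + q² |r|²)⁻¹ (1 - q r) = (1 - q̄ r̄) (1 - 2 Re(q) r̄ + |q|² r̄²)⁻¹` for the Cauchy
kernel, from which they follow (`bergman_numerator_mul_denom`). They say that conjugation exchanges
the variables of `secondForm`, so that regularity in the first variable, visible from the
holomorphic left coefficients on each slice (`sliceRegularOn_secondForm`), gives right
anti-regularity in the second. The same coefficients intertwine complex conjugation, which gives
the representation formula (`sliceExtension_secondForm`).
-/

namespace SliceBergman

open MeasureTheory Set Complex

/-! ### The Bergman kernel of the complex unit disc -/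

/-- The open unit disc of `ℂ` in real coordinates. -/
def unitDisc : Set (ℝ × ℝ) := {p | ‖Complex.mk p.1 p.2‖ < 1}

theorem continuous_complexMk : Continuous fun p : ℝ × ℝ => Complex.mk p.1 p.2 :=
  Complex.equivRealProdCLM.symm.continuous

theorem isOpen_unitDisc : IsOpen unitDisc :=
  isOpen_lt continuous_complexMk.norm continuous_const

theorem complexMk_polar (ρ θ : ℝ) :
    Complex.mk (ρ * Real.cos θ) (ρ * Real.sin θ) = circleMap 0 ρ θ := by
  rw [circleMap_zero, Complex.exp_mul_I]
  apply Complex.ext <;> simp [← Complex.ofReal_cos, ← Complex.ofReal_sin]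

/-- Integration over the disc in polar coordinates. -/
theorem integral_unitDisc_polar {F : ℝ × ℝ → ℂ} (hF : IntegrableOn F unitDisc) :
    ∫ p in unitDisc, F p = ∫ ρ in Ioo (0 : ℝ) 1, ∫ θ in Ioo (-Real.pi) Real.pi,
      ρ • F (ρ * Real.cos θ, ρ * Real.sin θ) := by
  set S : Set (ℝ × ℝ) := Ioo (0 : ℝ) 1 ×ˢ Ioo (-Real.pi) Real.pi with hS
  have hSm : MeasurableSet S := measurableSet_Ioo.prod measurableSet_Ioo
  have hST : S ⊆ polarCoord.target := prod_mono (fun x hx => hx.1) subset_rfl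
  have hinj : InjOn polarCoord.symm S := polarCoord.symm.injOn.mono hST
  have himage : polarCoord.symm '' S = unitDisc ∩ polarCoord.source := by
    have hnorm : ∀ p : ℝ × ℝ, 0 < p.1 → (polarCoord.symm p ∈ unitDisc ↔ p.1 < 1) := by
      intro p hp
      change ‖Complex.mk (p.1 * Real.cos p.2) (p.1 * Real.sin p.2)‖ < 1 ↔ _
      rw [complexMk_polar, norm_circleMap_zero, abs_of_pos hp]
    ext p
    constructor
    · rintro ⟨s, hs, rfl⟩
      exact ⟨(hnorm s hs.1.1).2 hs.1.2, polarCoord.map_target (hST hs)⟩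
    · rintro ⟨hp, hps⟩
      have ht := polarCoord.map_source hps
      refine ⟨polarCoord p, ⟨⟨ht.1, ?_⟩, ht.2⟩, polarCoord.left_inv hps⟩
      rw [← hnorm _ ht.1, polarCoord.left_inv hps]
      exact hp
  have hae : (unitDisc ∩ polarCoord.source : Set (ℝ × ℝ)) =ᵐ[volume] unitDisc := by
    simpa using (ae_eq_refl unitDisc).inter polarCoord_source_ae_eq_univ
  have hderiv : ∀ p ∈ S, HasFDerivWithinAt polarCoord.symm (fderivPolarCoordSymm p) S p :=
    fun p _ => (hasFDerivAt_polarCoord_symm p).hasFDerivWithinAt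
  have habs : EqOn (fun p : ℝ × ℝ => |(fderivPolarCoordSymm p).det| • F (polarCoord.symm p))
      (fun p => p.1 • F (polarCoord.symm p)) S := by
    intro p hp
    simp only [det_fderivPolarCoordSymm, abs_of_pos hp.1.1]
  have hint : IntegrableOn (fun p : ℝ × ℝ => p.1 • F (polarCoord.symm p)) S := by
    rw [← integrableOn_congr_fun habs hSm,
      ← integrableOn_image_iff_integrableOn_abs_det_fderiv_smul volume hSm hderiv hinj, himage]
    exact hF.mono_set inter_subset_left
  rw [← setIntegral_congr_set hae, ← himage,
    integral_image_eq_integral_abs_det_fderiv_smul volume hSm hderiv hinj,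
    setIntegral_congr_fun hSm habs, Measure.volume_eq_prod, hS, setIntegral_prod _ hint]
  rfl

theorem one_sub_mul_conj_ne_zero {w z : ℂ} (hw : ‖w‖ < 1) (hz : ‖z‖ < 1) :
    1 - w * star z ≠ 0 := by
  intro h
  have h1 : ‖w * star z‖ = 1 := by rw [← sub_eq_zero.1 h, norm_one]
  rw [norm_mul, norm_star] at h1
  nlinarith [norm_nonneg w, norm_nonneg z]

/-- On the circle of radius `ρ` one has `z̄ = ρ² / z`, so the Bergman kernel becomes the Cauchy
kernel for the derivative at `w ρ²`. -/
theorem integral_bergman_circle {g : ℂ → ℂ} (hg : DifferentiableOn ℂ g (Metric.ball 0 1))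
    {w : ℂ} (hw : ‖w‖ < 1) {ρ : ℝ} (hρ : ρ ∈ Ioo (0 : ℝ) 1) :
    ∫ θ in Ioo (-Real.pi) Real.pi,
        ((1 - w * star (circleMap 0 ρ θ)) ^ 2)⁻¹ * g (circleMap 0 ρ θ)
      = 2 * Real.pi * deriv (fun u => u * g u) (w * ρ ^ 2) := by
  have hρ0 : (ρ : ℂ) ≠ 0 := by exact_mod_cast hρ.1.ne'
  have hw0 : w * (ρ : ℂ) ^ 2 ∈ Metric.ball (0 : ℂ) ρ := by
    rw [mem_ball_zero_iff, norm_mul, norm_pow, Complex.norm_real, Real.norm_eq_abs,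
      abs_of_pos hρ.1]
    nlinarith [hρ.1, hρ.2, norm_nonneg w, mul_pos hρ.1 hρ.1]
  have hcauchy := two_pi_I_inv_smul_circleIntegral_sub_sq_inv_smul_of_differentiable
    Metric.isOpen_ball (Metric.closedBall_subset_ball hρ.2)
    (differentiableOn_id.mul hg) hw0
  have hpt : ∀ θ : ℝ, ((1 - w * star (circleMap 0 ρ θ)) ^ 2)⁻¹ * g (circleMap 0 ρ θ)
      = -I * (deriv (circleMap 0 ρ) θ • ((circleMap 0 ρ θ - w * (ρ : ℂ) ^ 2) ^ 2)⁻¹ •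
        (circleMap 0 ρ θ * g (circleMap 0 ρ θ))) := by
    intro θ
    have hz0 : circleMap 0 ρ θ ≠ 0 := circleMap_ne_center hρ.1.ne'
    have hconj : star (circleMap 0 ρ θ) = ρ ^ 2 / circleMap 0 ρ θ := by
      rw [eq_div_iff hz0, mul_comm]
      have := Complex.mul_conj (circleMap 0 ρ θ)
      rw [Complex.normSq_eq_norm_sq, norm_circleMap_zero, sq_abs] at this
      exact_mod_cast this
    have hsq : 1 - w * star (circleMap 0 ρ θ)
        = (circleMap 0 ρ θ - w * (ρ : ℂ) ^ 2) / circleMap 0 ρ θ := by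
      rw [hconj]; field_simp
    rw [hsq, deriv_circleMap, div_pow, inv_div, smul_eq_mul, smul_eq_mul]
    linear_combination ((circleMap 0 ρ θ) ^ 2 / (circleMap 0 ρ θ - w * (ρ : ℂ) ^ 2) ^ 2
      * g (circleMap 0 ρ θ)) * Complex.I_mul_I
  have hper : Function.Periodic (fun θ : ℝ => deriv (circleMap 0 ρ) θ •
      ((circleMap 0 ρ θ - w * (ρ : ℂ) ^ 2) ^ 2)⁻¹ •
        (circleMap 0 ρ θ * g (circleMap 0 ρ θ))) (2 * Real.pi) := by
    intro θ
    simp only [deriv_circleMap, periodic_circleMap 0 ρ θ]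
  have hshift := hper.intervalIntegral_add_eq (-Real.pi) 0
  rw [show -Real.pi + 2 * Real.pi = Real.pi by ring, zero_add] at hshift
  simp_rw [hpt]
  rw [← integral_Ioc_eq_integral_Ioo, integral_const_mul,
    ← intervalIntegral.integral_of_le (by linarith [Real.pi_pos]), hshift]
  have hc : (∮ z in C(0, ρ), ((z - w * (ρ : ℂ) ^ 2) ^ 2)⁻¹ • (z * g z))
      = 2 * Real.pi * I * deriv (fun u => u * g u) (w * ρ ^ 2) := by
    have h2 : (2 * Real.pi * I : ℂ) ≠ 0 := Complex.two_pi_I_ne_zero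
    rw [smul_eq_mul, inv_mul_eq_iff_eq_mul₀ h2] at hcauchy
    exact hcauchy
  rw [circleIntegral] at hc
  rw [hc]
  linear_combination (-2 * Real.pi * deriv (fun u => u * g u) (w * ρ ^ 2)) * Complex.I_mul_I

/-- For fixed `w` in the disc the kernel is bounded, by `(1 - |w|)⁻²`. -/
theorem integrableOn_bergman_mul {g : ℂ → ℂ}
    (hint : IntegrableOn (fun p : ℝ × ℝ => g (Complex.mk p.1 p.2)) unitDisc)
    {w : ℂ} (hw : ‖w‖ < 1) :
    IntegrableOn (fun p : ℝ × ℝ => ((1 - w * star (Complex.mk p.1 p.2)) ^ 2)⁻¹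
      * g (Complex.mk p.1 p.2)) unitDisc := by
  refine Integrable.bdd_mul hint (c := ((1 - ‖w‖) ^ 2)⁻¹) ?_ ?_
  · refine ContinuousOn.aestronglyMeasurable ?_ isOpen_unitDisc.measurableSet
    refine ContinuousOn.inv₀ ?_ fun p hp => pow_ne_zero 2 (one_sub_mul_conj_ne_zero hw hp)
    have := continuous_complexMk
    fun_prop
  · filter_upwards [ae_restrict_mem isOpen_unitDisc.measurableSet] with p hp
    have hp' : ‖Complex.mk p.1 p.2‖ < 1 := hp
    rw [norm_inv, norm_pow]
    have h1 : 1 - ‖w‖ ≤ ‖1 - w * star (Complex.mk p.1 p.2)‖ := by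
      have h2 := norm_sub_norm_le (1 : ℂ) (w * star (Complex.mk p.1 p.2))
      rw [norm_one, norm_mul, norm_star] at h2
      nlinarith [norm_nonneg w]
    have h3 : 0 < 1 - ‖w‖ := by linarith
    gcongr

/-- The reproducing property of the Bergman kernel of the unit disc of `ℂ`. In polar coordinates
the integral over the circle of radius `ρ` is `2 π (u g)'(w ρ²)`, and `ρ` times this is the
derivative of `π ρ² g(w ρ²)`. -/
theorem integral_bergman_mul {g : ℂ → ℂ} (hg : DifferentiableOn ℂ g (Metric.ball 0 1))
    (hint : IntegrableOn (fun p : ℝ × ℝ => g (Complex.mk p.1 p.2)) unitDisc)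
    {w : ℂ} (hw : ‖w‖ < 1) :
    ∫ p in unitDisc, ((1 - w * star (Complex.mk p.1 p.2)) ^ 2)⁻¹ * g (Complex.mk p.1 p.2)
      = Real.pi * g w := by
  have hH : DifferentiableOn ℂ (fun u => u * g u) (Metric.ball 0 1) := differentiableOn_id.mul hg
  have hmaps : ∀ t ∈ Icc (0 : ℝ) 1, w * (t : ℂ) ^ 2 ∈ Metric.ball (0 : ℂ) 1 := by
    intro t ht
    rw [mem_ball_zero_iff, norm_mul, norm_pow, Complex.norm_real, Real.norm_eq_abs,
      abs_of_nonneg ht.1]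
    have : t ^ 2 ≤ 1 := pow_le_one₀ ht.1 ht.2
    nlinarith [norm_nonneg w]
  rw [integral_unitDisc_polar (integrableOn_bergman_mul hint hw)]
  have hinner : EqOn (fun ρ : ℝ => ∫ θ in Ioo (-Real.pi) Real.pi,
      ρ • (((1 - w * star (Complex.mk (ρ * Real.cos θ) (ρ * Real.sin θ))) ^ 2)⁻¹
        * g (Complex.mk (ρ * Real.cos θ) (ρ * Real.sin θ))))
      (fun ρ : ℝ => (ρ : ℂ) * (2 * Real.pi * deriv (fun u => u * g u) (w * ρ ^ 2)))
      (Ioo 0 1) := by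
    intro ρ hρ
    simp only [complexMk_polar]
    rw [integral_smul, integral_bergman_circle hg hw hρ, Complex.real_smul]
  rw [setIntegral_congr_fun measurableSet_Ioo hinner, ← integral_Ioc_eq_integral_Ioo,
    ← intervalIntegral.integral_of_le zero_le_one]
  have hderiv : ∀ t ∈ uIcc (0 : ℝ) 1, HasDerivAt
      (fun ρ : ℝ => (Real.pi : ℂ) * ((ρ : ℂ) ^ 2 * g (w * (ρ : ℂ) ^ 2)))
      ((t : ℂ) * (2 * Real.pi * deriv (fun u => u * g u) (w * t ^ 2))) t := by
    intro t ht
    rw [uIcc_of_le zero_le_one] at ht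
    have hgt := (hg.differentiableAt (Metric.isOpen_ball.mem_nhds (hmaps t ht))).hasDerivAt
    have hHt : deriv (fun u => u * g u) (w * t ^ 2)
        = 1 * g (w * t ^ 2) + w * t ^ 2 * deriv g (w * t ^ 2) :=
      ((hasDerivAt_id _).mul hgt).deriv
    have hsq : HasDerivAt (fun z : ℂ => z ^ 2) (2 * (t : ℂ)) (t : ℂ) := by
      simpa using hasDerivAt_pow 2 (t : ℂ)
    have hcomp : HasDerivAt (fun z : ℂ => g (w * z ^ 2))
        (deriv g (w * t ^ 2) * (w * (2 * t))) (t : ℂ) :=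
      HasDerivAt.comp (t : ℂ) (h₂ := g) (h := fun z : ℂ => w * z ^ 2) hgt (hsq.const_mul w)
    have := ((hsq.mul hcomp).const_mul (Real.pi : ℂ)).comp_ofReal
    refine this.congr_deriv ?_
    rw [hHt]; ring
  have hcont : ContinuousOn
      (fun t : ℝ => (t : ℂ) * (2 * Real.pi * deriv (fun u => u * g u) (w * (t : ℂ) ^ 2)))
      (uIcc 0 1) := by
    rw [uIcc_of_le zero_le_one]
    have h1 := (hH.deriv Metric.isOpen_ball).continuousOn.comp
      (f := fun t : ℝ => w * (t : ℂ) ^ 2) (by fun_prop) hmaps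
    exact (Complex.continuous_ofReal.continuousOn).mul (continuousOn_const.mul h1)
  rw [intervalIntegral.integral_eq_sub_of_hasDerivAt hderiv hcont.intervalIntegrable]
  simp

/-! ### The slices as copies of the complex plane -/

theorem star_of_mem_imagUnits {I : ℍ} (hI : I ∈ imagUnits) : star I = -I := by
  ext <;> simp [hI.1]

theorem mul_self_of_mem_imagUnits {I : ℍ} (hI : I ∈ imagUnits) : I * I = -1 := by
  have h := Quaternion.self_mul_star I
  rw [star_of_mem_imagUnits hI, Quaternion.normSq_eq_norm_mul_self, hI.2] at h
  rw [← neg_eq_iff_eq_neg, ← mul_neg, h]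
  norm_num

/-- The embedding `x + i y ↦ x + y I` of `ℂ` onto the plane `ℂ(I)`, as an algebra map. -/
noncomputable def sliceHom {I : ℍ} (hI : I ∈ imagUnits) : ℂ →ₐ[ℝ] ℍ :=
  Complex.liftAux I (mul_self_of_mem_imagUnits hI)

section sliceHom

variable {I : ℍ} (hI : I ∈ imagUnits)

theorem sliceHom_apply (z : ℂ) : sliceHom hI z = slicePoint I z.re z.im := rfl

theorem sliceHom_mk (x y : ℝ) : sliceHom hI ⟨x, y⟩ = slicePoint I x y := rfl

theorem sliceHom_I : sliceHom hI Complex.I = I := Complex.liftAux_apply_I _ _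

theorem star_sliceHom (z : ℂ) : star (sliceHom hI z) = sliceHom hI (star z) := by
  simp [sliceHom_apply, slicePoint, star_of_mem_imagUnits hI]

theorem re_sliceHom (z : ℂ) : (sliceHom hI z).re = z.re := by
  simp [sliceHom_apply, slicePoint, hI.1]

theorem norm_sliceHom (z : ℂ) : ‖sliceHom hI z‖ = ‖z‖ := by
  have h := Quaternion.self_mul_star (sliceHom hI z)
  rw [star_sliceHom, ← map_mul, Complex.star_def, Complex.mul_conj, Complex.normSq_eq_norm_sq,
    Quaternion.normSq_eq_norm_mul_self] at h
  have h2 := congrArg QuaternionAlgebra.re h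
  rw [re_sliceHom, Complex.ofReal_re, Quaternion.re_coe, ← sq] at h2
  exact ((sq_eq_sq₀ (norm_nonneg _) (norm_nonneg _)).1 h2).symm

theorem sliceHom_mem_unitBall {z : ℂ} : sliceHom hI z ∈ unitBall ↔ ‖z‖ < 1 := by
  rw [unitBall, mem_ofPred_eq, norm_sliceHom]

end sliceHom

theorem sliceSet_unitBall {I : ℍ} (hI : I ∈ imagUnits) : sliceSet unitBall I = unitDisc := by
  ext p
  exact sliceHom_mem_unitBall hI (z := ⟨p.1, p.2⟩)

theorem mem_slicePlane_iff {I : ℍ} (hI : I ∈ imagUnits) {q : ℍ} :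
    q ∈ slicePlane I ↔ ∃ z, sliceHom hI z = q :=
  ⟨fun ⟨x, y, h⟩ => ⟨⟨x, y⟩, h.symm⟩, fun ⟨z, h⟩ => ⟨z.re, z.im, h.symm⟩⟩

theorem slicePoint_unitOf (q : ℍ) : slicePoint (unitOf q) q.re ‖q.im‖ = q := by
  rw [slicePoint, unitOf]
  by_cases h : q.im = 0
  · rw [h, norm_zero, zero_smul, add_zero]
    conv_rhs => rw [← Quaternion.re_add_im q, h, add_zero]
  · rw [smul_inv_smul₀ (norm_ne_zero_iff.2 h), Quaternion.re_add_im]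

theorem unitOf_mem_imagUnits {q : ℍ} (h : q.im ≠ 0) : unitOf q ∈ imagUnits := by
  refine ⟨by simp [unitOf], ?_⟩
  rw [unitOf, norm_smul, norm_inv, norm_norm, inv_mul_cancel₀ (norm_ne_zero_iff.2 h)]

/-- Every quaternion lies on some slice; the given unit `J` serves for the real ones. -/
theorem exists_sliceHom_eq {J : ℍ} (hJ : J ∈ imagUnits) (q : ℍ) :
    ∃ (I : ℍ) (hI : I ∈ imagUnits) (z : ℂ), sliceHom hI z = q := by
  by_cases h : q.im = 0
  · exact ⟨J, hJ, q.re, by conv_rhs => rw [← Quaternion.re_add_im q, h, add_zero]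
                           simp⟩
  · exact ⟨unitOf q, unitOf_mem_imagUnits h, ⟨q.re, ‖q.im‖⟩, slicePoint_unitOf q⟩

theorem isOpen_unitBall : IsOpen unitBall := isOpen_lt continuous_norm continuous_const

theorem hasDerivAt_slicePoint_left (I : ℍ) (x y : ℝ) :
    HasDerivAt (fun t : ℝ => slicePoint I t y) 1 x := by
  have h := ((hasDerivAt_id x).smul_const (1 : ℍ)).add_const (y • I)
  rw [one_smul] at h
  refine h.congr_of_eventuallyEq (Filter.Eventually.of_forall fun t => ?_)
  simp [slicePoint, ← Algebra.algebraMap_eq_smul_one]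

theorem hasDerivAt_slicePoint_right (I : ℍ) (x y : ℝ) :
    HasDerivAt (fun t : ℝ => slicePoint I x t) I y := by
  have h := ((hasDerivAt_id y).smul_const I).const_add (x : ℍ)
  rwa [one_smul] at h

/-! ### Slice regular functions -/

theorem SliceRegularOn.congr {f g : ℍ → ℍ} {Ω : Set ℍ} (hΩ : IsOpen Ω) (hf : SliceRegularOn f Ω)
    (h : EqOn g f Ω) : SliceRegularOn g Ω := by
  refine ⟨hf.1.congr h, fun I hI x y hp => ?_⟩
  have hx := (hasDerivAt_slicePoint_left I x y).continuousAt.eventually (hΩ.mem_nhds hp)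
  have hy := (hasDerivAt_slicePoint_right I x y).continuousAt.eventually (hΩ.mem_nhds hp)
  rw [Filter.EventuallyEq.deriv_eq (hx.mono fun t ht => h ht),
    Filter.EventuallyEq.deriv_eq (hy.mono fun t ht => h ht)]
  exact hf.2 I hI x y hp

theorem starModule_real_quaternion : StarModule ℝ ℍ :=
  ⟨fun t q => by ext <;> simp⟩

/-- Conjugation turns left slice regularity into slice right anti-regularity. -/
theorem SliceRegularOn.star {f : ℍ → ℍ} {Ω : Set ℍ} (hf : SliceRegularOn f Ω) :
    SliceRightAntiRegularOn (fun q => star (f q)) Ω := by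
  have := starModule_real_quaternion
  refine ⟨hf.1.star, fun I hI x y hp => ?_⟩
  rw [deriv.star, deriv.star]
  have h := congrArg Star.star (hf.2 I hI x y hp)
  rwa [star_add, star_mul, star_of_mem_imagUnits hI, mul_neg, ← sub_eq_add_neg, star_zero] at h

theorem SliceRightAntiRegularOn.congr {f g : ℍ → ℍ} {Ω : Set ℍ} (hΩ : IsOpen Ω)
    (hf : SliceRightAntiRegularOn f Ω) (h : EqOn g f Ω) : SliceRightAntiRegularOn g Ω := by
  refine ⟨hf.1.congr h, fun I hI x y hp => ?_⟩
  have hx := (hasDerivAt_slicePoint_left I x y).continuousAt.eventually (hΩ.mem_nhds hp)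
  have hy := (hasDerivAt_slicePoint_right I x y).continuousAt.eventually (hΩ.mem_nhds hp)
  rw [Filter.EventuallyEq.deriv_eq (hx.mono fun t ht => h ht),
    Filter.EventuallyEq.deriv_eq (hy.mono fun t ht => h ht)]
  exact hf.2 I hI x y hp

/-- The real linear map `q ↦ Re (q c) - i Re (I q c)`. It is complex linear when `ℍ` is a complex
vector space through left multiplication by `ℂ(I)`. -/
noncomputable def complexPart (I c : ℍ) : ℍ →L[ℝ] ℂ :=
  LinearMap.toContinuousLinearMap
    { toFun := fun q => ⟨(q * c).re, -(I * q * c).re⟩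
      map_add' := fun p q => by
        apply Complex.ext
        · simp only [add_mul, Quaternion.re_add, Complex.add_re]
        · simp only [mul_add, add_mul, Quaternion.re_add, Complex.add_im, neg_add]
      map_smul' := fun t q => by
        apply Complex.ext <;> simp [-Quaternion.re_mul] }

theorem complexPart_apply (I c q : ℍ) :
    complexPart I c q = ⟨(q * c).re, -(I * q * c).re⟩ := rfl

theorem complexPart_sliceHom_mul {I : ℍ} (hI : I ∈ imagUnits) (c : ℍ) (w : ℂ) (q : ℍ) :
    complexPart I c (sliceHom hI w * q) = w * complexPart I c q := by
  have h1 : sliceHom hI w * q * c = w.re • (q * c) + w.im • (I * q * c) := by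
    rw [sliceHom_apply, slicePoint, ← Quaternion.algebraMap_def, Algebra.algebraMap_eq_smul_one]
    simp only [add_mul, smul_mul_assoc, one_mul]
  have h2 : I * (sliceHom hI w * q) * c = w.re • (I * q * c) - w.im • (q * c) := by
    rw [mul_assoc, h1, mul_add, mul_smul_comm, mul_smul_comm, ← mul_assoc, ← mul_assoc I (I * q),
      ← mul_assoc I I, mul_self_of_mem_imagUnits hI, neg_one_mul, neg_mul, smul_neg,
      ← sub_eq_add_neg, mul_assoc I q c]
  rw [complexPart_apply, complexPart_apply, h1, h2]
  apply Complex.ext <;>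
    simp only [Complex.mul_re, Complex.mul_im, Quaternion.re_add, Quaternion.re_sub,
      Quaternion.re_smul, smul_eq_mul] <;> ring

/-- The components `complexPart I c` separate points: the real part of `complexPart I c p` is
`Re (p c)`, and `c` is arbitrary. -/
theorem eq_of_complexPart_eq {I p q : ℍ} (h : ∀ c, complexPart I c p = complexPart I c q) :
    p = q := by
  have h1 := congrArg Complex.re (h (star (p - q)))
  simp only [complexPart_apply] at h1
  rw [← sub_eq_zero, ← Quaternion.re_sub, ← sub_mul, Quaternion.self_mul_star,
    Quaternion.re_coe, Quaternion.normSq_eq_zero] at h1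
  exact sub_eq_zero.1 h1

/-- The splitting lemma: on a slice, the complex components of a slice regular function are
holomorphic. -/
theorem SliceRegularOn.differentiableAt_complexPart {f : ℍ → ℍ} {Ω : Set ℍ} (hΩ : IsOpen Ω)
    (hf : SliceRegularOn f Ω) {I : ℍ} (hI : I ∈ imagUnits) (c : ℍ) {z : ℂ}
    (hz : sliceHom hI z ∈ Ω) :
    DifferentiableAt ℂ (fun u => complexPart I c (f (sliceHom hI u))) z := by
  have hfd := (hf.1.differentiableAt (hΩ.mem_nhds hz)).hasFDerivAt
  set L := fderiv ℝ f (sliceHom hI z)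
  have hφ : HasFDerivAt (sliceHom hI)
      (LinearMap.toContinuousLinearMap (sliceHom hI).toLinearMap) z :=
    (LinearMap.toContinuousLinearMap (sliceHom hI).toLinearMap).hasFDerivAt
  have hF : HasFDerivAt (fun u => complexPart I c (f (sliceHom hI u)))
      ((complexPart I c).comp (L.comp
        (LinearMap.toContinuousLinearMap (sliceHom hI).toLinearMap))) z :=
    (complexPart I c).hasFDerivAt.comp z (hfd.comp z hφ)
  rw [differentiableAt_complex_iff_differentiableAt_real]
  refine ⟨hF.differentiableAt, ?_⟩
  rw [hF.fderiv]
  have hx : deriv (fun t : ℝ => f (slicePoint I t z.im)) z.re = L 1 :=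
    (hfd.comp_hasDerivAt z.re (hasDerivAt_slicePoint_left I z.re z.im)).deriv
  have hy : deriv (fun t : ℝ => f (slicePoint I z.re t)) z.im = L I :=
    (hfd.comp_hasDerivAt z.im (hasDerivAt_slicePoint_right I z.re z.im)).deriv
  have hreg := hf.2 I hI z.re z.im hz
  rw [hx, hy] at hreg
  have hLI : L I = sliceHom hI Complex.I * L 1 := by
    rw [sliceHom_I, eq_neg_of_add_eq_zero_left hreg, mul_neg, ← mul_assoc,
      mul_self_of_mem_imagUnits hI, neg_one_mul, neg_neg]
  change complexPart I c (L (sliceHom hI Complex.I))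
    = Complex.I • complexPart I c (L (sliceHom hI 1))
  rw [map_one, sliceHom_I, hLI, complexPart_sliceHom_mul, smul_eq_mul]

/-- The identity principle: every slice of the ball meets `ℂ(J)` in the real diameter, and the
complex components of both functions are holomorphic there. -/
theorem SliceRegularOn.eqOn_unitBall {f g : ℍ → ℍ} (hf : SliceRegularOn f unitBall)
    (hg : SliceRegularOn g unitBall) {J : ℍ} (hJ : J ∈ imagUnits)
    (h : EqOn f g (unitBall ∩ slicePlane J)) : EqOn f g unitBall := by
  intro q hq
  obtain ⟨I, hI, z, rfl⟩ := exists_sliceHom_eq hJ q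
  refine eq_of_complexPart_eq (I := I) fun c => ?_
  have hmem : ∀ u ∈ Metric.ball (0 : ℂ) 1, sliceHom hI u ∈ unitBall := fun u hu =>
    (sliceHom_mem_unitBall hI).2 (mem_ball_zero_iff.1 hu)
  have han : ∀ k : ℍ → ℍ, SliceRegularOn k unitBall →
      AnalyticOnNhd ℂ (fun u => complexPart I c (k (sliceHom hI u))) (Metric.ball 0 1) :=
    fun k hk => DifferentiableOn.analyticOnNhd
      (fun u hu => (hk.differentiableAt_complexPart isOpen_unitBall hI c
        (hmem u hu)).differentiableWithinAt) Metric.isOpen_ball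
  refine (han f hf).eqOn_of_preconnected_of_frequently_eq (han g hg)
    (convex_ball (0 : ℂ) 1).isPreconnected (Metric.mem_ball_self one_pos) ?_
    (mem_ball_zero_iff.2 ((sliceHom_mem_unitBall hI).1 hq))
  have htend : Filter.Tendsto (fun t : ℝ => (t : ℂ)) (nhdsWithin 0 {0}ᶜ) (nhdsWithin 0 {0}ᶜ) := by
    refine tendsto_nhdsWithin_iff.2 ⟨?_, ?_⟩
    · exact (Complex.continuous_ofReal.tendsto' 0 0 Complex.ofReal_zero).mono_left
        nhdsWithin_le_nhds
    · filter_upwards [self_mem_nhdsWithin] with t ht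
      simpa using ht
  refine htend.frequently (Filter.Eventually.frequently ?_)
  have hlt : ∀ᶠ t : ℝ in nhdsWithin 0 {0}ᶜ, (t : ℂ) ∈ Metric.ball (0 : ℂ) 1 :=
    htend.eventually (nhdsWithin_le_nhds (Metric.ball_mem_nhds 0 one_pos))
  filter_upwards [hlt] with t ht
  rw [h ⟨hmem t ht, t, 0, by simp [slicePoint]⟩]

/-! ### The closed form of the kernel -/

/-- `1 - 2 z Re(r) + z² |r|²` for complex `z`: since its coefficients are real, this polynomial
commutes with the embedding of `ℂ` onto any slice. -/
noncomputable def sliceDenom (r : ℍ) (z : ℂ) : ℂ :=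
  1 - 2 * z * (r.re : ℂ) + z ^ 2 * ((‖r‖ ^ 2 : ℝ) : ℂ)

theorem sliceHom_sliceDenom {I : ℍ} (hI : I ∈ imagUnits) (r : ℍ) (z : ℂ) :
    sliceHom hI (sliceDenom r z)
      = 1 - 2 * sliceHom hI z * (r.re : ℍ) + sliceHom hI z ^ 2 * ((‖r‖ ^ 2 : ℝ) : ℍ) := by
  have h : ∀ t : ℝ, sliceHom hI (t : ℂ) = (t : ℍ) := fun t => (sliceHom hI).commutes t
  simp only [sliceDenom, map_add, map_sub, map_mul, map_pow, map_one, map_ofNat, h]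

/-- For `r` on a slice, with complex coordinate `v`, the denominator factors. -/
theorem sliceDenom_sliceHom {J : ℍ} (hJ : J ∈ imagUnits) (v z : ℂ) :
    sliceDenom (sliceHom hJ v) z = (1 - z * v) * (1 - z * star v) := by
  have h1 : ((v.re : ℝ) : ℂ) * 2 = v + star v := by
    rw [Complex.star_def, Complex.add_conj]; push_cast; ring
  have h2 : ((‖v‖ ^ 2 : ℝ) : ℂ) = v * star v := by
    rw [Complex.star_def, Complex.mul_conj, Complex.normSq_eq_norm_sq]
  rw [sliceDenom, re_sliceHom, norm_sliceHom, h2]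
  linear_combination (-z) * h1

theorem sliceDenom_star (r : ℍ) (z : ℂ) : sliceDenom r (star z) = star (sliceDenom r z) := by
  simp [sliceDenom]

theorem one_sub_mul_ne_zero {z v : ℂ} (hz : ‖z‖ < 1) (hv : ‖v‖ < 1) : 1 - z * v ≠ 0 := by
  simpa using one_sub_mul_conj_ne_zero (z := star v) hz (by rwa [norm_star])

theorem sliceDenom_ne_zero {J : ℍ} (hJ : J ∈ imagUnits) {r : ℍ} (hr : r ∈ unitBall) {z : ℂ}
    (hz : ‖z‖ < 1) : sliceDenom r z ≠ 0 := by
  obtain ⟨I, hI, v, rfl⟩ := exists_sliceHom_eq hJ r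
  rw [sliceHom_mem_unitBall] at hr
  rw [sliceDenom_sliceHom]
  exact mul_ne_zero (one_sub_mul_ne_zero hz hr) (one_sub_mul_conj_ne_zero hz hr)

theorem imagUnits_nonempty : imagUnits.Nonempty := by
  refine ⟨Quaternion.coeComplex Complex.I, by simp, ?_⟩
  rw [← sq_eq_sq₀ (norm_nonneg _) zero_le_one, sq, ← Quaternion.normSq_eq_norm_mul_self,
    Quaternion.normSq_def']
  simp

theorem secondForm_denom_ne_zero {q r : ℍ} (hq : q ∈ unitBall) (hr : r ∈ unitBall) :
    1 - 2 * q * (r.re : ℍ) + q ^ 2 * ((‖r‖ ^ 2 : ℝ) : ℍ) ≠ 0 := by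
  obtain ⟨J, hJ⟩ := imagUnits_nonempty
  obtain ⟨I, hI, z, rfl⟩ := exists_sliceHom_eq hJ q
  rw [← sliceHom_sliceDenom]
  exact (map_ne_zero _).2 (sliceDenom_ne_zero hJ hr ((sliceHom_mem_unitBall hI).1 hq))

/-- The functions `hₖ(z) = π⁻¹ zᵏ (1 - 2 z Re(r) + z² |r|²)⁻²`. They are holomorphic on the disc,
intertwine conjugation, and give `secondForm q r = h₀(q) - 2 h₁(q) r + h₂(q) r²` on each slice. -/
noncomputable def sliceCoeff (r : ℍ) (k : ℕ) (z : ℂ) : ℂ :=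
  (1 / Real.pi : ℝ) * z ^ k * (sliceDenom r z ^ 2)⁻¹

theorem secondForm_sliceHom {I : ℍ} (hI : I ∈ imagUnits) (z : ℂ) (r : ℍ) :
    secondForm (sliceHom hI z) r = sliceHom hI (sliceCoeff r 0 z)
      + (-2 : ℝ) • (sliceHom hI (sliceCoeff r 1 z) * r)
      + sliceHom hI (sliceCoeff r 2 z) * r ^ 2 := by
  have hc : ∀ k, sliceCoeff r k z = (1 / Real.pi : ℝ) • ((sliceDenom r z ^ 2)⁻¹ * z ^ k) := by
    intro k; rw [sliceCoeff, Complex.real_smul]; ring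
  rw [secondForm, ← sliceHom_sliceDenom, zpow_neg, hc, hc, hc]
  simp only [map_smul, map_mul, map_inv₀, map_pow, pow_zero, pow_one, mul_one]
  rw [smul_mul_assoc, smul_mul_assoc, smul_comm, ← smul_add, ← smul_add, neg_smul, two_smul,
    show ((2 : ℤ)) = ((2 : ℕ) : ℤ) from rfl, zpow_natCast]
  congr 1
  noncomm_ring

theorem sliceCoeff_star (r : ℍ) (k : ℕ) (z : ℂ) :
    sliceCoeff r k (star z) = star (sliceCoeff r k z) := by
  rw [sliceCoeff, sliceDenom_star, sliceCoeff]
  simp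

theorem differentiableAt_sliceCoeff {r : ℍ} (hr : r ∈ unitBall) (k : ℕ) {z : ℂ} (hz : ‖z‖ < 1) :
    DifferentiableAt ℂ (sliceCoeff r k) z := by
  obtain ⟨J, hJ⟩ := imagUnits_nonempty
  have h1 : DifferentiableAt ℂ (sliceDenom r) z := by unfold sliceDenom; fun_prop
  exact ((differentiableAt_const _).mul (differentiableAt_pow k)).mul
    ((h1.pow 2).inv (pow_ne_zero 2 (sliceDenom_ne_zero hJ hr hz)))

theorem hasDerivAt_sliceHom_left {I : ℍ} (hI : I ∈ imagUnits) {h : ℂ → ℂ} {x y : ℝ} {h' : ℂ}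
    (hh : HasDerivAt h h' ⟨x, y⟩) :
    HasDerivAt (fun t : ℝ => sliceHom hI (h ⟨t, y⟩)) (sliceHom hI h') x := by
  have h1 : HasDerivAt (fun t : ℝ => Complex.mk t y) 1 x := by
    refine ((hasDerivAt_id x).ofReal_comp.add_const (y * Complex.I)).congr_of_eventuallyEq
      (Filter.Eventually.of_forall fun t => ?_)
    apply Complex.ext <;> simp
  have h2 := hh.comp x h1
  rw [mul_one] at h2
  exact (LinearMap.toContinuousLinearMap (sliceHom hI).toLinearMap).hasFDerivAt.comp_hasDerivAt x h2

theorem hasDerivAt_sliceHom_right {I : ℍ} (hI : I ∈ imagUnits) {h : ℂ → ℂ} {x y : ℝ} {h' : ℂ}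
    (hh : HasDerivAt h h' ⟨x, y⟩) :
    HasDerivAt (fun t : ℝ => sliceHom hI (h ⟨x, t⟩)) (I * sliceHom hI h') y := by
  have h1 : HasDerivAt (fun t : ℝ => Complex.mk x t) Complex.I y := by
    have h3 := ((hasDerivAt_id y).ofReal_comp.mul_const Complex.I).const_add (x : ℂ)
    rw [Complex.ofReal_one, one_mul] at h3
    refine h3.congr_of_eventuallyEq (Filter.Eventually.of_forall fun t => ?_)
    apply Complex.ext <;> simp
  have h2 := hh.comp y h1
  have h4 := (LinearMap.toContinuousLinearMap (sliceHom hI).toLinearMap).hasFDerivAt.comp_hasDerivAt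
    y h2
  refine h4.congr_deriv ?_
  change sliceHom hI (h' * Complex.I) = _
  rw [mul_comm, map_mul, sliceHom_I]

/-- On each slice the first variable enters only through the holomorphic left factors
`sliceCoeff r k`. -/
theorem sliceRegularOn_secondForm {r : ℍ} (hr : r ∈ unitBall) :
    SliceRegularOn (fun q => secondForm q r) unitBall := by
  constructor
  · intro q hq
    have h1 : DifferentiableAt ℝ
        (fun q : ℍ => 1 - 2 * q * (r.re : ℍ) + q ^ 2 * ((‖r‖ ^ 2 : ℝ) : ℍ)) q := by fun_prop
    have h2 : DifferentiableAt ℝ (fun q : ℍ => 1 - 2 * q * r + q ^ 2 * r ^ 2) q := by fun_prop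
    have h3 := (((h1.pow 2).inv (pow_ne_zero 2 (secondForm_denom_ne_zero hq hr))).mul h2).const_smul
      (1 / Real.pi : ℝ)
    refine (h3.congr_of_eventuallyEq (Filter.Eventually.of_forall fun p => ?_)).differentiableWithinAt
    simp only [secondForm, zpow_neg]
    rfl
  · intro I hI x y hp
    have hz : ‖(⟨x, y⟩ : ℂ)‖ < 1 := (sliceHom_mem_unitBall hI).1 hp
    have hd : ∀ k, HasDerivAt (sliceCoeff r k) (deriv (sliceCoeff r k) ⟨x, y⟩) ⟨x, y⟩ := fun k =>
      (differentiableAt_sliceCoeff hr k hz).hasDerivAt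
    have hx := ((hasDerivAt_sliceHom_left hI (hd 0)).add
      (((hasDerivAt_sliceHom_left hI (hd 1)).mul_const r).const_smul (-2 : ℝ))).add
      ((hasDerivAt_sliceHom_left hI (hd 2)).mul_const (r ^ 2))
    have hy := ((hasDerivAt_sliceHom_right hI (hd 0)).add
      (((hasDerivAt_sliceHom_right hI (hd 1)).mul_const r).const_smul (-2 : ℝ))).add
      ((hasDerivAt_sliceHom_right hI (hd 2)).mul_const (r ^ 2))
    have hx' := hx.congr_of_eventuallyEq (f₁ := fun t : ℝ => secondForm (slicePoint I t y) r)
      (Filter.Eventually.of_forall fun t => secondForm_sliceHom hI ⟨t, y⟩ r)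
    have hy' := hy.congr_of_eventuallyEq (f₁ := fun t : ℝ => secondForm (slicePoint I x t) r)
      (Filter.Eventually.of_forall fun t => secondForm_sliceHom hI ⟨x, t⟩ r)
    rw [hx'.deriv, hy'.deriv]
    simp only [mul_assoc, ← mul_smul_comm, ← mul_add]
    rw [← mul_assoc I I, mul_self_of_mem_imagUnits hI, neg_one_mul, add_neg_cancel]

/-- The two closed forms of the Cauchy kernel `∑ aⁿ dⁿ`, after clearing denominators. Here `b` and
`c` stand for the conjugates of `a` and `d`; only the centrality of traces and norms is used. -/
theorem one_sub_mul_mul_denom {R : Type*} [Ring R] {a b c d : R}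
    (h1 : c * (a + b) = (a + b) * c) (h2 : c * (a * b) = a * b * c)
    (h3 : (c + d) * b = b * (c + d)) (h4 : c * d * b = b * (c * d)) :
    (1 - a * c) * (1 - (a + b) * d + a * b * d ^ 2)
      = (1 - a * (c + d) + a ^ 2 * (c * d)) * (1 - b * d) := by
  have hl : (1 - a * c) * (1 - (a + b) * d + a * b * d ^ 2)
      = 1 - (a + b) * d + a * b * d ^ 2 - a * c + a * (c * (a + b)) * d
        - a * (c * (a * b)) * d ^ 2 := by noncomm_ring
  have hr : (1 - a * (c + d) + a ^ 2 * (c * d)) * (1 - b * d)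
      = 1 - b * d - a * (c + d) + a * ((c + d) * b) * d + a ^ 2 * (c * d)
        - a ^ 2 * (c * d * b) * d := by noncomm_ring
  rw [hl, hr, h1, h2, h3, h4]
  noncomm_ring

/-- The two closed forms of the Bergman kernel `∑ (n + 1) aⁿ dⁿ`, after clearing denominators,
from those of the Cauchy kernel. -/
theorem bergman_numerator_mul_denom {R : Type*} [Ring R] {a b c d s t : R}
    (hab : a * b = b * a) (hcd : c * d = d * c) (hc : c * t = t * c) (hd : d * t = t * d)
    (ha : a * s = s * a) (hb : b * s = s * b) (h : (1 - a * c) * t = s * (1 - b * d)) :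
    (1 - 2 * a * c + a ^ 2 * c ^ 2) * t ^ 2 = s ^ 2 * (1 - 2 * b * d + b ^ 2 * d ^ 2) := by
  have hct : c * t ^ 2 = t * t * c := by rw [sq, ← mul_assoc, hc, mul_assoc, hc, mul_assoc]
  have hsb : s ^ 2 * b = b * s * s := by rw [sq, mul_assoc, ← hb, ← mul_assoc, ← hb]
  calc (1 - 2 * a * c + a ^ 2 * c ^ 2) * t ^ 2
      = (1 - a * c) * t * t - a * (1 - a * c) * (c * t ^ 2) := by noncomm_ring
    _ = (1 - a * c) * t * t - a * ((1 - a * c) * t) * (t * c) := by rw [hct]; noncomm_ring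
    _ = s * (1 - b * d) * t - (a * s) * (1 - b * d) * (c * t) := by rw [h, hc]; noncomm_ring
    _ = s * (1 - b * d - a * c + (a * b) * (d * c)) * t := by rw [ha]; noncomm_ring
    _ = s * (1 - b * d - a * c + (b * a) * (c * d)) * t := by rw [hab, hcd]
    _ = s * ((1 - a * c) * t) - (s * b) * (1 - a * c) * (t * d) := by rw [← hd]; noncomm_ring
    _ = s * ((1 - a * c) * t) - b * s * ((1 - a * c) * t) * d := by rw [← hb]; noncomm_ring
    _ = s ^ 2 * (1 - b * d) - (b * s * s) * (1 - b * d) * d := by rw [h]; noncomm_ring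
    _ = s ^ 2 * (1 - 2 * b * d + b ^ 2 * d ^ 2) := by rw [← hsb]; noncomm_ring

theorem star_secondForm_denom (q r : ℍ) :
    star (1 - 2 * r * (q.re : ℍ) + r ^ 2 * ((‖q‖ ^ 2 : ℝ) : ℍ))
      = 1 - 2 * (q.re : ℍ) * star r + ((‖q‖ ^ 2 : ℝ) : ℍ) * star r ^ 2 := by
  simp only [star_add, star_sub, star_mul, star_one, star_pow, star_ofNat, Quaternion.star_coe]
  noncomm_ring

theorem star_firstForm (q r : ℍ) : star (firstForm q r) = secondForm r q := by
  have := starModule_real_quaternion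
  rw [firstForm, secondForm, ← star_secondForm_denom, star_smul, star_mul, star_zpow₀, star_star]
  congr 2
  simp only [star_add, star_sub, star_mul, star_one, star_pow, star_ofNat, star_star]
  noncomm_ring

theorem firstForm_eq_secondForm {q r : ℍ} (hq : q ∈ unitBall) (hr : r ∈ unitBall) :
    firstForm q r = secondForm q r := by
  have hq1 : 2 * (q.re : ℍ) = q + star q := by rw [Quaternion.self_add_star]
  have hr1 : 2 * (r.re : ℍ) = r + star r := by rw [Quaternion.self_add_star]
  have hq2 : ((‖q‖ ^ 2 : ℝ) : ℍ) = q * star q := by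
    rw [Quaternion.self_mul_star, Quaternion.normSq_eq_norm_mul_self, sq]
  have hr2 : ((‖r‖ ^ 2 : ℝ) : ℍ) = r * star r := by
    rw [Quaternion.self_mul_star, Quaternion.normSq_eq_norm_mul_self, sq]
  have e1 : 2 * q * (r.re : ℍ) = q * (2 * (r.re : ℍ)) := by noncomm_ring
  have e2 : ∀ (t : ℝ) (p : ℍ), p * (2 * (t : ℍ)) = 2 * (t : ℍ) * p := fun t p => by
    rw [two_mul, add_mul, mul_add, Quaternion.coe_commutes]
  set s := 1 - 2 * q * (r.re : ℍ) + q ^ 2 * ((‖r‖ ^ 2 : ℝ) : ℍ) with hs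
  set t := 1 - 2 * (q.re : ℍ) * star r + ((‖q‖ ^ 2 : ℝ) : ℍ) * star r ^ 2 with ht
  have hs0 : s ≠ 0 := secondForm_denom_ne_zero hq hr
  have ht0 : t ≠ 0 := by
    rw [ht, ← star_secondForm_denom]
    exact star_ne_zero.2 (secondForm_denom_ne_zero hr hq)
  have hab : q * star q = star q * q := by rw [Quaternion.self_mul_star, Quaternion.star_mul_self]
  have hcd : r * star r = star r * r := by rw [Quaternion.self_mul_star, Quaternion.star_mul_self]
  have hcauchy : (1 - q * r) * t = s * (1 - star q * star r) := by
    rw [hs, ht, e1, hq1, hr1, hq2, hr2]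
    refine one_sub_mul_mul_denom ?_ ?_ ?_ ?_
    · rw [← hq1, e2]
    · rw [← hq2, Quaternion.coe_commutes]
    · rw [← hr1, e2]
    · rw [← hr2, Quaternion.coe_commutes]
  have ht_comm : ∀ p, Commute p (star r) → Commute p t := fun p hp =>
    ((Commute.one_right p).sub_right ((show Commute p _ from e2 _ p).mul_right hp)).add_right
      ((Quaternion.coe_commute _ p).symm.mul_right (hp.pow_right 2))
  have hs_comm : ∀ p, Commute p q → Commute p s := fun p hp => by
    rw [hs, e1]
    exact ((Commute.one_right p).sub_right (hp.mul_right (show Commute p _ from e2 _ p))).add_right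
      ((hp.pow_right 2).mul_right (Quaternion.coe_commute _ p).symm)
  have hmain := bergman_numerator_mul_denom hab hcd (ht_comm r hcd) (ht_comm _ (Commute.refl _))
    (hs_comm q (Commute.refl _)) (hs_comm _ hab.symm) hcauchy
  rw [firstForm, secondForm, ← hs, ← ht]
  congr 1
  rw [zpow_neg, zpow_neg, show ((2 : ℤ)) = ((2 : ℕ) : ℤ) from rfl, zpow_natCast, zpow_natCast,
    ← div_eq_mul_inv, div_eq_iff (pow_ne_zero 2 ht0), mul_assoc _⁻¹, hmain,
    inv_mul_cancel_left₀ (pow_ne_zero 2 hs0)]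

theorem star_secondForm {q r : ℍ} (hq : q ∈ unitBall) (hr : r ∈ unitBall) :
    star (secondForm q r) = secondForm r q := by
  rw [← firstForm_eq_secondForm hq hr, star_firstForm]

/-- Conjugation exchanges the two variables of `secondForm`, and turns left regularity into right
anti-regularity. -/
theorem sliceRightAntiRegularOn_secondForm {q : ℍ} (hq : q ∈ unitBall) :
    SliceRightAntiRegularOn (fun r => secondForm q r) unitBall :=
  (sliceRegularOn_secondForm hq).star.congr isOpen_unitBall fun _ hr => (star_secondForm hr hq).symm

/-! ### The representation formula -/

/-- The representation formula for the embeddings of `ℂ` onto the slices. -/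
theorem half_smul_slice_combination {I J : ℍ} (hI : I ∈ imagUnits) (hJ : J ∈ imagUnits) (v : ℂ) :
    (1 / 2 : ℝ) • ((1 - I * J) * sliceHom hJ v) + (1 / 2 : ℝ) • ((1 + I * J) * sliceHom hJ (star v))
      = sliceHom hI v := by
  have h1 : (1 - I * J) * sliceHom hJ v + (1 + I * J) * sliceHom hJ (star v)
      = (2 : ℝ) • sliceHom hI v := by
    have hJJ := mul_self_of_mem_imagUnits hJ
    simp only [sliceHom_apply, slicePoint, Complex.star_def, Complex.conj_re, Complex.conj_im,
      ← Quaternion.algebraMap_def, Algebra.algebraMap_eq_smul_one]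
    have h2 : I * J * J = -I := by rw [mul_assoc, hJJ, mul_neg_one]
    simp only [sub_mul, add_mul, mul_add, one_mul, mul_one, mul_smul_comm, h2, neg_smul, mul_neg]
    module
  rw [← smul_add, h1, smul_smul]
  norm_num

/-- `secondForm · r` satisfies the representation formula, since its coefficients on a slice
intertwine conjugation. -/
theorem sliceExtension_secondForm {J : ℍ} (hJ : J ∈ imagUnits) (q r : ℍ) :
    sliceExtension J (fun z => secondForm z r) q = secondForm q r := by
  by_cases h : q.im = 0
  · have hq : slicePoint J q.re 0 = q := by
      conv_rhs => rw [← Quaternion.re_add_im q, h]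
      simp [slicePoint]
    simp only [sliceExtension, unitOf, h, norm_zero, neg_zero, hq, smul_zero, zero_mul, sub_zero,
      add_zero, one_mul]
    rw [← add_smul]
    norm_num
  · have hI := unitOf_mem_imagUnits h
    have hq := secondForm_sliceHom hI ⟨q.re, ‖q.im‖⟩ r
    rw [sliceHom_mk, slicePoint_unitOf] at hq
    have h1 := secondForm_sliceHom hJ ⟨q.re, ‖q.im‖⟩ r
    have h2 := secondForm_sliceHom hJ (star ⟨q.re, ‖q.im‖⟩) r
    simp only [sliceCoeff_star] at h2
    have h3 : sliceHom hJ (star ⟨q.re, ‖q.im‖⟩) = slicePoint J q.re (-‖q.im‖) := rfl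
    rw [h3] at h2
    rw [sliceHom_mk] at h1
    simp only [sliceExtension]
    rw [hq, h1, h2]
    rw [← half_smul_slice_combination hI hJ, ← half_smul_slice_combination hI hJ,
      ← half_smul_slice_combination hI hJ]
    generalize 1 - unitOf q * J = A
    generalize 1 + unitOf q * J = B
    simp only [add_mul, smul_mul_assoc, mul_add, mul_smul_comm, mul_assoc]
    module

/-! ### The evaluation representers of a slice -/

theorem volume_unitDisc_lt_top : volume unitDisc < ⊤ := by
  have h : unitDisc ⊆ Metric.ball (0 : ℝ × ℝ) 1 := fun p hp => by
    have hp' : ‖Complex.mk p.1 p.2‖ < 1 := hp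
    rw [mem_ball_zero_iff, Prod.norm_def, max_lt_iff]
    exact ⟨(Complex.abs_re_le_norm (Complex.mk p.1 p.2)).trans_lt hp',
      (Complex.abs_im_le_norm (Complex.mk p.1 p.2)).trans_lt hp'⟩
  exact (measure_mono h).trans_lt Metric.isBounded_ball.measure_lt_top

theorem continuous_slicePoint (I : ℍ) : Continuous fun p : ℝ × ℝ => slicePoint I p.1 p.2 :=
  (Quaternion.continuous_coe.comp continuous_fst).add (continuous_snd.smul continuous_const)

theorem SliceRegularOn.continuousOn_slice {f : ℍ → ℍ} {Ω : Set ℍ} (hf : SliceRegularOn f Ω)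
    (I : ℍ) : ContinuousOn (fun p : ℝ × ℝ => f (slicePoint I p.1 p.2)) (sliceSet Ω I) :=
  hf.1.continuousOn.comp (continuous_slicePoint I).continuousOn fun _ hp => hp

theorem isOpen_sliceSet {Ω : Set ℍ} (hΩ : IsOpen Ω) (I : ℍ) : IsOpen (sliceSet Ω I) :=
  hΩ.preimage (continuous_slicePoint I)

/-- The integrand of the inner product is integrable, by `|f̄ g| ≤ |f|² + |g|²`. -/
theorem integrableOn_star_mul {Ω : Set ℍ} (hΩ : IsOpen Ω) {I : ℍ} {f g : ℍ → ℍ}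
    (hf : f ∈ bergmanSpace Ω I) (hg : g ∈ bergmanSpace Ω I) :
    IntegrableOn (fun p : ℝ × ℝ => star (f (slicePoint I p.1 p.2)) * g (slicePoint I p.1 p.2))
      (sliceSet Ω I) := by
  refine Integrable.mono' (hf.2.add hg.2)
    (((hf.1.continuousOn_slice I).star.mul (hg.1.continuousOn_slice I)).aestronglyMeasurable
      (isOpen_sliceSet hΩ I).measurableSet) (Filter.Eventually.of_forall fun p => ?_)
  rw [norm_mul, norm_star, Pi.add_apply]
  nlinarith [sq_nonneg (‖f (slicePoint I p.1 p.2)‖ - ‖g (slicePoint I p.1 p.2)‖),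
    sq_nonneg ‖f (slicePoint I p.1 p.2)‖, sq_nonneg ‖g (slicePoint I p.1 p.2)‖]

theorem integrableOn_of_mem_bergmanSpace {I : ℍ} (hI : I ∈ imagUnits) {f : ℍ → ℍ}
    (hf : f ∈ bergmanSpace unitBall I) :
    IntegrableOn (fun p : ℝ × ℝ => f (slicePoint I p.1 p.2)) unitDisc := by
  have hsq := hf.2
  have hc := hf.1.continuousOn_slice I
  rw [sliceSet_unitBall hI] at hsq hc
  refine Integrable.mono' (hsq.add (integrableOn_const (C := (1 : ℝ)) volume_unitDisc_lt_top.ne))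
    (hc.aestronglyMeasurable isOpen_unitDisc.measurableSet) (Filter.Eventually.of_forall fun p => ?_)
  rw [Pi.add_apply]
  nlinarith [sq_nonneg (‖f (slicePoint I p.1 p.2)‖ - 1), norm_nonneg (f (slicePoint I p.1 p.2))]

/-- The Bergman inner product is hermitian. No integrability is needed, because conjugation is a
continuous linear equivalence. -/
theorem star_bergmanInner (Ω : Set ℍ) (I : ℍ) (f g : ℍ → ℍ) :
    star (bergmanInner Ω I f g) = bergmanInner Ω I g f := by
  have := starModule_real_quaternion
  have h := (starL' ℝ : ℍ ≃L[ℝ] ℍ).integral_comp_comm (μ := volume.restrict (sliceSet Ω I))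
    (fun p : ℝ × ℝ => star (f (slicePoint I p.1 p.2)) * g (slicePoint I p.1 p.2))
  simp only [starL'_apply, star_mul, star_star] at h
  exact h.symm

/-- On a slice `secondForm` is the classical Bergman kernel of the disc. -/
theorem secondForm_sliceHom_sliceHom {J : ℍ} (hJ : J ∈ imagUnits) {z w : ℂ} (hz : ‖z‖ < 1)
    (hw : ‖w‖ < 1) : secondForm (sliceHom hJ z) (sliceHom hJ w)
      = sliceHom hJ ((1 / Real.pi : ℝ) • ((1 - z * star w) ^ 2)⁻¹) := by
  have h1 := one_sub_mul_ne_zero hz hw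
  have h2 := one_sub_mul_conj_ne_zero hz hw
  rw [secondForm, ← sliceHom_sliceDenom, sliceDenom_sliceHom, map_smul]
  have h3 : ((1 - z * w) * (1 - z * star w)) ^ (-2 : ℤ) * (1 - 2 * z * w + z ^ 2 * w ^ 2)
      = ((1 - z * star w) ^ 2)⁻¹ := by
    rw [zpow_neg, show ((2 : ℤ)) = ((2 : ℕ) : ℤ) from rfl, zpow_natCast]
    field_simp
    ring
  rw [← h3]
  simp only [map_add, map_sub, map_mul, map_pow, map_zpow₀, map_one, map_ofNat]

theorem secondForm_mem_bergmanSpace {J : ℍ} (hJ : J ∈ imagUnits) {w : ℂ} (hw : ‖w‖ < 1) :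
    (fun r => secondForm r (sliceHom hJ w)) ∈ bergmanSpace unitBall J := by
  have hreg := sliceRegularOn_secondForm ((sliceHom_mem_unitBall hJ).2 hw)
  refine ⟨hreg, ?_⟩
  have hc := hreg.continuousOn_slice J
  rw [sliceSet_unitBall hJ] at hc ⊢
  refine Integrable.mono' (integrableOn_const (C := (1 / Real.pi * ((1 - ‖w‖) ^ 2)⁻¹) ^ 2)
    volume_unitDisc_lt_top.ne)
    ((hc.norm.pow 2).aestronglyMeasurable isOpen_unitDisc.measurableSet) ?_
  filter_upwards [ae_restrict_mem isOpen_unitDisc.measurableSet] with p hp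
  have hp' : ‖Complex.mk p.1 p.2‖ < 1 := hp
  have h1 : 1 - ‖w‖ ≤ ‖1 - Complex.mk p.1 p.2 * star w‖ := by
    have h2 := norm_sub_norm_le (1 : ℂ) (Complex.mk p.1 p.2 * star w)
    rw [norm_one, norm_mul, norm_star] at h2
    nlinarith [norm_nonneg w]
  have h3 : 0 < 1 - ‖w‖ := by linarith
  have h4 : 0 < 1 / Real.pi := by positivity
  rw [norm_pow, norm_norm, ← sliceHom_mk hJ, secondForm_sliceHom_sliceHom hJ hp' hw,
    norm_sliceHom, norm_smul, norm_inv, norm_pow, Real.norm_of_nonneg h4.le]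
  gcongr

/-- The complex components reduce the reproducing property to that of the Bergman kernel of the
disc. -/
theorem isEvalRepresenter_secondForm {J : ℍ} (hJ : J ∈ imagUnits) {q : ℍ}
    (hq : q ∈ unitBall ∩ slicePlane J) :
    IsEvalRepresenter unitBall J q (fun r => secondForm r q) := by
  obtain ⟨hq, hqJ⟩ := hq
  obtain ⟨w, rfl⟩ := (mem_slicePlane_iff hJ).1 hqJ
  have hw := (sliceHom_mem_unitBall hJ).1 hq
  have hK := secondForm_mem_bergmanSpace hJ hw
  refine ⟨hK, fun f hf => ?_⟩
  have hint := integrableOn_star_mul isOpen_unitBall hK hf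
  rw [bergmanInner]
  rw [sliceSet_unitBall hJ] at hint ⊢
  -- In `complexPart J c` the kernel, which takes values in `ℂ(J)`, is a complex scalar factor.
  refine eq_of_complexPart_eq (I := J) fun c => ?_
  rw [← (complexPart J c).integral_comp_comm hint]
  have hF : DifferentiableOn ℂ (fun u => complexPart J c (f (sliceHom hJ u))) (Metric.ball 0 1) :=
    fun u hu => (hf.1.differentiableAt_complexPart isOpen_unitBall hJ c
      ((sliceHom_mem_unitBall hJ).2 (mem_ball_zero_iff.1 hu))).differentiableWithinAt
  have hFint : IntegrableOn (fun p : ℝ × ℝ => complexPart J c (f (sliceHom hJ ⟨p.1, p.2⟩)))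
      unitDisc := (complexPart J c).integrable_comp (integrableOn_of_mem_bergmanSpace hJ hf)
  have hpt : EqOn (fun p : ℝ × ℝ => complexPart J c
        (star (secondForm (slicePoint J p.1 p.2) (sliceHom hJ w)) * f (slicePoint J p.1 p.2)))
      (fun p => (1 / Real.pi : ℝ) • (((1 - w * star (Complex.mk p.1 p.2)) ^ 2)⁻¹
        * complexPart J c (f (sliceHom hJ ⟨p.1, p.2⟩)))) unitDisc := by
    intro p hp
    simp only
    rw [← sliceHom_mk hJ, star_secondForm ((sliceHom_mem_unitBall hJ).2 hp) hq,
      secondForm_sliceHom_sliceHom hJ hw hp, complexPart_sliceHom_mul, smul_mul_assoc]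
  rw [setIntegral_congr_fun isOpen_unitDisc.measurableSet hpt, integral_smul,
    integral_bergman_mul hF hFint hw, Complex.real_smul, ← mul_assoc, ← Complex.ofReal_mul,
    one_div, inv_mul_cancel₀ Real.pi_ne_zero, Complex.ofReal_one, one_mul]

/-- A representer `K'` is evaluated on the slice by pairing it with the explicit representers,
and off the slice by the identity principle. -/
theorem IsEvalRepresenter.eqOn_secondForm {J : ℍ} (hJ : J ∈ imagUnits) {q : ℍ}
    (hq : q ∈ unitBall ∩ slicePlane J) {K' : ℍ → ℍ} (hK' : IsEvalRepresenter unitBall J q K') :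
    EqOn K' (fun r => secondForm r q) unitBall := by
  refine hK'.1.1.eqOn_unitBall (sliceRegularOn_secondForm hq.1) hJ fun p hp => ?_
  have hp' := isEvalRepresenter_secondForm hJ hp
  rw [hp'.2 K' hK'.1, ← star_bergmanInner, ← hK'.2 _ hp'.1]
  exact star_secondForm hq.1 hp.1

theorem planeKernel_eq_secondForm {J : ℍ} (hJ : J ∈ imagUnits) {q r : ℍ}
    (hq : q ∈ unitBall ∩ slicePlane J) (hr : r ∈ unitBall) :
    planeKernel unitBall J q r = secondForm q r := by
  have h : IsEvalRepresenter unitBall J q (evalRepresenter unitBall J q) :=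
    Classical.epsilon_spec ⟨_, isEvalRepresenter_secondForm hJ hq⟩
  rw [planeKernel, h.eqOn_secondForm hJ hq hr]
  exact star_secondForm hr hq.1

theorem bergmanKernel_eq_secondForm {J : ℍ} (hJ : J ∈ imagUnits) {q r : ℍ} (hq : q ∈ unitBall)
    (hr : r ∈ unitBall) : bergmanKernel unitBall J q r = secondForm q r := by
  have hmem : ∀ y : ℝ, |y| = ‖q.im‖ → slicePoint J q.re y ∈ unitBall ∩ slicePlane J := by
    intro y hy
    refine ⟨?_, q.re, y, rfl⟩
    obtain ⟨I, hI, z, rfl⟩ := exists_sliceHom_eq hJ q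
    have him : (sliceHom hI z).im = z.im • I := by
      have h := Quaternion.re_add_im (sliceHom hI z)
      rw [re_sliceHom] at h
      exact add_left_cancel h
    rw [him, norm_smul, hI.2, mul_one, Real.norm_eq_abs] at hy
    rw [← sliceHom_mk hJ, sliceHom_mem_unitBall, re_sliceHom]
    have hz := (sliceHom_mem_unitBall hI).1 hq
    rw [Complex.norm_def, Complex.normSq_apply] at hz ⊢
    rwa [← abs_mul_abs_self y, hy, abs_mul_abs_self]
  rw [← sliceExtension_secondForm hJ q r, bergmanKernel, sliceExtension, sliceExtension,
    planeKernel_eq_secondForm hJ (hmem _ (abs_of_nonneg (norm_nonneg _))) hr,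
    planeKernel_eq_secondForm hJ (hmem _ (by rw [abs_neg, abs_of_nonneg (norm_nonneg _)])) hr]

end SliceBergman

theorem mainTheorem2 :
    (∀ J ∈ SliceBergman.imagUnits,
      ∀ q ∈ SliceBergman.unitBall ∩ SliceBergman.slicePlane J,
        ∃ K : ℍ → ℍ, SliceBergman.IsEvalRepresenter SliceBergman.unitBall J q K ∧
          ∀ K' : ℍ → ℍ, SliceBergman.IsEvalRepresenter SliceBergman.unitBall J q K' →
            Set.EqOn K' K SliceBergman.unitBall) ∧
    (∀ J ∈ SliceBergman.imagUnits,
      ∀ q ∈ SliceBergman.unitBall, ∀ r ∈ SliceBergman.unitBall,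
        SliceBergman.bergmanKernel SliceBergman.unitBall J q r = SliceBergman.secondForm q r) ∧
    (∀ q ∈ SliceBergman.unitBall, ∀ r ∈ SliceBergman.unitBall,
      SliceBergman.firstForm q r = SliceBergman.secondForm q r) ∧
    (∀ r ∈ SliceBergman.unitBall,
      SliceBergman.SliceRegularOn
        (fun q => SliceBergman.secondForm q r) SliceBergman.unitBall) ∧
    (∀ q ∈ SliceBergman.unitBall,
      SliceBergman.SliceRightAntiRegularOn
        (fun r => SliceBergman.secondForm q r) SliceBergman.unitBall) ∧
    (∀ J ∈ SliceBergman.imagUnits, ∀ r ∈ SliceBergman.unitBall,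
      SliceBergman.SliceRegularOn
        (fun q => SliceBergman.bergmanKernel SliceBergman.unitBall J q r)
        SliceBergman.unitBall) ∧
    (∀ J ∈ SliceBergman.imagUnits, ∀ q ∈ SliceBergman.unitBall,
      SliceBergman.SliceRightAntiRegularOn
        (fun r => SliceBergman.bergmanKernel SliceBergman.unitBall J q r)
        SliceBergman.unitBall) := by

  open SliceBergman in
  refine ⟨fun J hJ q hq => ⟨_, isEvalRepresenter_secondForm hJ hq, fun K' hK' =>
      hK'.eqOn_secondForm hJ hq⟩,
    fun J hJ q hq r hr => bergmanKernel_eq_secondForm hJ hq hr,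
    fun q hq r hr => firstForm_eq_secondForm hq hr,
    fun r hr => sliceRegularOn_secondForm hr,
    fun q hq => sliceRightAntiRegularOn_secondForm hq,
    fun J hJ r hr => (sliceRegularOn_secondForm hr).congr isOpen_unitBall
      fun q hq => bergmanKernel_eq_secondForm hJ hq hr,
    fun J hJ q hq => (sliceRightAntiRegularOn_secondForm hq).congr isOpen_unitBall
      fun r hr => bergmanKernel_eq_secondForm hJ hq hr⟩
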